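/- **Proposition 4.1 (non-generic Adinkras).** For $N\ge 2$, an $N$-colored Adinkra $\mathcal{A}$ is a finite, simple, connected graph $G$ in which every edge carries a sign in $\{\pm 1\}$ and one of $N$ colors, such that: (1) $G$ is bipartite; (2) every vertex is incident to exactly one edge of each color; (3) for every two distinct colors, the spanning subgraph formed by the edges of these two colors is a disjoint union of $4$-cycles; (4) each such bi-colored $4$-cycle contains an odd number of negative edges. Let $v$ be the number of vertices of $G$, and define $m$ by requiring that the rank over $\mathbb{F}_2$ of the ordinary (unsigned) Laplacian of $G$ be $v/2-m$; call $\mathcal{A}$ non-generic if $m>0$. Let $L(\mathcal{A})=D-A_\sigma$ be the signed Laplacian, where $D$ is the diagonal matrix of vertex degrees and $A_\sigma$ is the adjacency matrix in which each edge is represented by its sign. Fix an arbitrary color $c$, and let $\hat L(\mathcal{A})$ be the matrix over $\mathbb{Z}[x]$ obtained from $L(\mathcal{A})$ by replacing every diagonal entry by $x+(N-1)$ and by multiplying by $x$ every off-diagonal entry $\pm1$ that corresponds to an edge of color $c$. If $\mathcal{A}$ is non-generic, then $\hat L(\mathcal{A})$ has no Smith normal form over $\mathbb{Z}[x]$: there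 are no invertible matrices $P,Q\in GL_v(\mathbb{Z}[x])$ such that $P\,\hat L(\mathcal{A})\,Q=\operatorname{diag}(\hat f_1,\dots,\hat f_v)$ with $\hat f_1\mid \hat f_2\mid\cdots\mid \hat f_v$. -/

import Mathlib

open Polynomial

/-- A simple graph on `V` with a sign on each edge (`-1` is a negative edge) and a color, one of
`N`, on each edge. -/
structure SignedColoredGraph (N : ℕ) (V : Type*) where
  /-- the underlying graph -/
  graph : SimpleGraph V
  /-- the signature -/
  sign : graph.edgeSet → ℤˣ
  /-- the edge coloring -/
  color : graph.edgeSet → Fin N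

namespace SignedColoredGraph

variable {N : ℕ} {V : Type*}

/-- The spanning subgraph consisting of the edges of color `c` or `d`. -/
def bicolored (S : SignedColoredGraph N V) (c d : Fin N) : SimpleGraph V where
  Adj u v := ∃ h : S.graph.Adj u v, S.color ⟨s(u, v), h⟩ = c ∨ S.color ⟨s(u, v), h⟩ = d
  symm := ⟨by
    rintro u v ⟨h, hc⟩
    refine ⟨h.symm, ?_⟩
    have e : (⟨s(v, u), h.symm⟩ : S.graph.edgeSet) = ⟨s(u, v), h⟩ := Subtype.ext Sym2.eq_swap
    rwa [e]⟩
  loopless := ⟨fun v h => h.1.ne rfl⟩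

end SignedColoredGraph

/-- An `N`-colored Adinkra on the vertex set `V` (without a choice of orientation, which plays no
role for the Laplacian). -/
structure Adinkra (N : ℕ) (V : Type*) extends SignedColoredGraph N V where
  two_le : 2 ≤ N
  connected : graph.Connected
  bipartite : graph.IsBipartite
  /-- every vertex is incident to exactly one edge of each color -/
  existsUnique_edge : ∀ (v : V) (c : Fin N), ∃! e : graph.edgeSet, v ∈ e.val ∧ color e = c
  /-- for distinct colors, the bicolored subgraph is a disjoint union of `4`-cycles -/
  bicolored_component : ∀ c d : Fin N, c ≠ d →
    ∀ K : (toSignedColoredGraph.bicolored c d).ConnectedComponent,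
      Nonempty (K.toSimpleGraph ≃g SimpleGraph.cycleGraph 4)
  /-- every bicolored `4`-cycle `w x y z` has an odd number of negative edges -/
  odd_negative : ∀ c d : Fin N, c ≠ d → ∀ w x y z : V, w ≠ y → x ≠ z →
    ∀ (hwx : (toSignedColoredGraph.bicolored c d).Adj w x)
      (hxy : (toSignedColoredGraph.bicolored c d).Adj x y)
      (hyz : (toSignedColoredGraph.bicolored c d).Adj y z)
      (hzw : (toSignedColoredGraph.bicolored c d).Adj z w),
      Odd ([sign ⟨s(w, x), hwx.1⟩, sign ⟨s(x, y), hxy.1⟩,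
        sign ⟨s(y, z), hyz.1⟩, sign ⟨s(z, w), hzw.1⟩].count (-1))

namespace Adinkra

variable {N : ℕ} {V : Type*} [Fintype V] [DecidableEq V]

open scoped Classical in
/-- The signed adjacency matrix `A_σ`. -/
noncomputable def signedAdjMatrix (A : Adinkra N V) : Matrix V V ℤ :=
  Matrix.of fun u v => if h : A.graph.Adj u v then (A.sign ⟨s(u, v), h⟩ : ℤ) else 0

open scoped Classical in
/-- The signed Laplacian `L(𝒜) = D - A_σ`. -/
noncomputable def laplacian (A : Adinkra N V) : Matrix V V ℤ :=
  Matrix.diagonal (fun v => (A.graph.degree v : ℤ)) - A.signedAdjMatrix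

open scoped Classical in
/-- The deformed Laplacian `L̂(𝒜)` over `ℤ[x]` for the color `c`: the diagonal entries of `L(𝒜)`
become `x + (N - 1)`, and the entries `±1` at edges of color `c` become `±x`. -/
noncomputable def deformedLaplacian (A : Adinkra N V) (c : Fin N) : Matrix V V ℤ[X] :=
  Matrix.of fun u v =>
    if u = v then X + ((N : ℤ[X]) - 1)
    else if ∃ h : A.graph.Adj u v, A.color ⟨s(u, v), h⟩ = c then C (A.laplacian u v) * X
    else C (A.laplacian u v)

open scoped Classical in
/-- The rank over `𝔽₂` of the Laplacian of the underlying (unsigned) graph. -/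
noncomputable def twoRank (A : Adinkra N V) : ℕ :=
  (A.graph.lapMatrix (ZMod 2)).rank

/-- The number `m` for which the `2`-rank is `v / 2 - m`, where `v` is the number of vertices. -/
noncomputable def twoRankDefect (A : Adinkra N V) : ℚ :=
  (Fintype.card V : ℚ) / 2 - A.twoRank

/-- An Adinkra is non-generic if `m > 0`. -/
def IsNonGeneric (A : Adinkra N V) : Prop :=
  0 < A.twoRankDefect

end Adinkra

/-- The square matrix `M` over the commutative ring `R` has a Smith normal form: there are
invertible matrices `P`, `Q` over `R` with `P M Q` diagonal and with diagonal entries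
`f₁ ∣ f₂ ∣ ⋯ ∣ fᵥ` (along some enumeration `e` of the index set). -/
def HasSmithNormalForm {R ι : Type*} [CommRing R] [Fintype ι] [DecidableEq ι]
    (M : Matrix ι ι R) : Prop :=
  ∃ (P Q : Matrix.GeneralLinearGroup ι R) (e : ι ≃ Fin (Fintype.card ι))
    (f : Fin (Fintype.card ι) → R),
    (∀ i j, i ≤ j → f i ∣ f j) ∧
      (P : Matrix ι ι R) * M * (Q : Matrix ι ι R) = Matrix.diagonal fun i => f (e i)

/-! Put y = x + N - 1. Then L̂ = y - B, where B is a weighted sum of color matrices. These are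
involutions which anticommute pairwise, so B² is the scalar x² + N - 1. The rank of L̂ is at least
v/2 over every field where y ≠ 0, because the bipartition gives diagonal blocks y·I
(`card_le_two_mul_rank`). In characteristic 0 the case y = 0 is harmless too: there x = 1 - N and B²
= N(N - 1) ≠ 0, so the rank is v (`rank_deformedLaplacian_of_root`). Hence the rank is at least v/2
at every complex x. In a Smith normal form the invariant factor f_k, counted from 0, vanishes in a
field exactly when the rank there is at most k. Let k be the 2-rank, which is below v/2. Then f_k
vanishes at x = 1 modulo 2 but is not zero modulo 2, so it is not constant. At a complex root of f_k
the rank would be at most k < v/2, a contradiction. -/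

namespace Adinkra

/-! ### Colors as commuting involutions of the vertices -/

variable {N : ℕ} {V : Type*}

/-- `u` and `w` are joined by an edge of color `d`. -/
def ColorAdj (A : Adinkra N V) (d : Fin N) (u w : V) : Prop :=
  ∃ h : A.graph.Adj u w, A.color ⟨s(u, w), h⟩ = d

theorem ColorAdj.symm {A : Adinkra N V} {d : Fin N} {u w : V} (h : A.ColorAdj d u w) :
    A.ColorAdj d w u := by
  obtain ⟨h, hc⟩ := h
  refine ⟨h.symm, ?_⟩
  have e : (⟨s(w, u), h.symm⟩ : A.graph.edgeSet) = ⟨s(u, w), h⟩ := Subtype.ext Sym2.eq_swap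
  rwa [e]

theorem ColorAdj.color_unique {A : Adinkra N V} {d e : Fin N} {u w : V}
    (h : A.ColorAdj d u w) (h' : A.ColorAdj e u w) : d = e := by
  obtain ⟨_, rfl⟩ := h
  obtain ⟨_, rfl⟩ := h'
  rfl

theorem ColorAdj.right_unique {A : Adinkra N V} {d : Fin N} {u w w' : V}
    (h : A.ColorAdj d u w) (h' : A.ColorAdj d u w') : w = w' := by
  obtain ⟨h, hc⟩ := h
  obtain ⟨h', hc'⟩ := h'
  have := (A.existsUnique_edge u d).unique (y₁ := ⟨s(u, w), h⟩) (y₂ := ⟨s(u, w'), h'⟩)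
    ⟨by simp, hc⟩ ⟨by simp, hc'⟩
  exact Sym2.congr_right.1 (congrArg Subtype.val this)

theorem exists_colorAdj (A : Adinkra N V) (d : Fin N) (u : V) : ∃ w, A.ColorAdj d u w := by
  obtain ⟨⟨e, he⟩, ⟨hu, hc⟩, -⟩ := A.existsUnique_edge u d
  obtain ⟨w, rfl⟩ := Sym2.mem_iff_exists.1 hu
  exact ⟨w, he, hc⟩

/-- The neighbor of `u` along the edge of color `d`. -/
noncomputable def neighbor (A : Adinkra N V) (d : Fin N) (u : V) : V :=
  (A.exists_colorAdj d u).choose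

theorem colorAdj_neighbor (A : Adinkra N V) (d : Fin N) (u : V) :
    A.ColorAdj d u (A.neighbor d u) :=
  (A.exists_colorAdj d u).choose_spec

theorem colorAdj_iff (A : Adinkra N V) {d : Fin N} {u w : V} :
    A.ColorAdj d u w ↔ w = A.neighbor d u :=
  ⟨fun h => h.right_unique (A.colorAdj_neighbor d u), fun h => h ▸ A.colorAdj_neighbor d u⟩

theorem neighbor_neighbor (A : Adinkra N V) (d : Fin N) (u : V) :
    A.neighbor d (A.neighbor d u) = u :=
  (A.colorAdj_iff.1 (A.colorAdj_neighbor d u).symm).symm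

theorem neighbor_ne (A : Adinkra N V) {d e : Fin N} (h : d ≠ e) (u : V) :
    A.neighbor d u ≠ A.neighbor e u := fun he =>
  h ((A.colorAdj_neighbor d u).color_unique (he ▸ A.colorAdj_neighbor e u))

theorem bicolored_adj_iff (A : Adinkra N V) {d e : Fin N} {u w : V} :
    (A.bicolored d e).Adj u w ↔ A.ColorAdj d u w ∨ A.ColorAdj e u w := by
  simp only [SignedColoredGraph.bicolored, ColorAdj]
  exact exists_or

theorem cycleGraph_four_exists_opposite : ∀ a b c : Fin 4, b ≠ c →
    (SimpleGraph.cycleGraph 4).Adj a b → (SimpleGraph.cycleGraph 4).Adj a c →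
    ∃ z, z ≠ a ∧ (SimpleGraph.cycleGraph 4).Adj b z ∧ (SimpleGraph.cycleGraph 4).Adj c z := by
  decide

/-- Both sides are the corner opposite `u` in its bicolored 4-cycle. -/
theorem neighbor_comm (A : Adinkra N V) {d e : Fin N} (hde : d ≠ e) (u : V) :
    A.neighbor d (A.neighbor e u) = A.neighbor e (A.neighbor d u) := by
  set G := A.bicolored d e with hG
  set K := G.connectedComponentMk u with hK
  obtain ⟨φ⟩ := A.bicolored_component d e hde K
  have hd : G.Adj u (A.neighbor d u) := A.bicolored_adj_iff.2 (Or.inl (A.colorAdj_neighbor d u))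
  have he : G.Adj u (A.neighbor e u) := A.bicolored_adj_iff.2 (Or.inr (A.colorAdj_neighbor e u))
  have memd : A.neighbor d u ∈ K := SimpleGraph.ConnectedComponent.sound hd.symm.reachable
  have meme : A.neighbor e u ∈ K := SimpleGraph.ConnectedComponent.sound he.symm.reachable
  have hu : u ∈ K := rfl
  obtain ⟨z, hz, h1, h2⟩ := cycleGraph_four_exists_opposite (φ ⟨u, hu⟩) (φ ⟨_, memd⟩)
    (φ ⟨_, meme⟩) (fun h => A.neighbor_ne hde u (congrArg Subtype.val (φ.injective h)))
    (φ.map_adj_iff.2 hd) (φ.map_adj_iff.2 he)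
  obtain ⟨⟨z, hzK⟩, rfl⟩ := φ.surjective z
  have hzu : z ≠ u := fun h => hz (by subst h; rfl)
  have h1 : G.Adj (A.neighbor d u) z := φ.map_adj_iff.1 h1
  have h2 : G.Adj (A.neighbor e u) z := φ.map_adj_iff.1 h2
  -- An edge to `z ≠ u` cannot have the color that leads back to `u`, so its color is forced.
  rw [hG, bicolored_adj_iff, colorAdj_iff, colorAdj_iff, neighbor_neighbor] at h1 h2
  rcases h1 with h1 | h1
  · exact absurd h1 hzu
  rcases h2 with h2 | h2
  · rw [← h1, ← h2]
  · exact absurd h2 hzu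

theorem two_coloring_ne (A : Adinkra N V) (χ : A.graph.Coloring (Fin 2)) (d : Fin N) (u : V) :
    χ (A.neighbor d u) ≠ χ u :=
  fun h => χ.valid (A.colorAdj_neighbor d u).1 h.symm

/-! ### Signs around bicolored 4-cycles -/

theorem signedAdjMatrix_of_adj (A : Adinkra N V) {u w : V} (h : A.graph.Adj u w) :
    A.signedAdjMatrix u w = (A.sign ⟨s(u, w), h⟩ : ℤ) := by
  simp [signedAdjMatrix, h]

theorem signedAdjMatrix_symm (A : Adinkra N V) (u w : V) :
    A.signedAdjMatrix u w = A.signedAdjMatrix w u := by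
  by_cases h : A.graph.Adj u w
  · rw [A.signedAdjMatrix_of_adj h, A.signedAdjMatrix_of_adj h.symm]
    have e : (⟨s(w, u), h.symm⟩ : A.graph.edgeSet) = ⟨s(u, w), h⟩ := Subtype.ext Sym2.eq_swap
    rw [e]
  · have h' : ¬ A.graph.Adj w u := fun h' => h h'.symm
    simp [signedAdjMatrix, h, h']

theorem signedAdjMatrix_mul_self (A : Adinkra N V) {u w : V} (h : A.graph.Adj u w) :
    A.signedAdjMatrix u w * A.signedAdjMatrix u w = 1 := by
  rw [A.signedAdjMatrix_of_adj h]
  rcases Int.units_eq_one_or (A.sign ⟨s(u, w), h⟩) with h | h <;> simp [h]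

/-- An odd number of negative signs means that the product of all four is -1, and each sign is its
own inverse. -/
theorem units_mul_eq_neg_mul_of_odd_count :
    ∀ a b c d : ℤˣ, Odd ([a, b, c, d].count (-1)) → (a * b : ℤ) = -(d * c : ℤ) := by
  decide

theorem signedAdjMatrix_anticomm (A : Adinkra N V) {d e : Fin N} (hde : d ≠ e) (u : V) :
    A.signedAdjMatrix u (A.neighbor d u) *
        A.signedAdjMatrix (A.neighbor d u) (A.neighbor e (A.neighbor d u)) =
      -(A.signedAdjMatrix u (A.neighbor e u) *
        A.signedAdjMatrix (A.neighbor e u) (A.neighbor d (A.neighbor e u))) := by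
  have h1 := A.colorAdj_neighbor d u
  have h2 := A.colorAdj_neighbor e (A.neighbor d u)
  have h3 : A.ColorAdj d (A.neighbor e (A.neighbor d u)) (A.neighbor e u) := by
    rw [← A.neighbor_comm hde]
    exact (A.colorAdj_neighbor d (A.neighbor e u)).symm
  have h4 : A.ColorAdj e (A.neighbor e u) u := (A.colorAdj_neighbor e u).symm
  have hne : u ≠ A.neighbor e (A.neighbor d u) := fun h => A.neighbor_ne hde (A.neighbor d u) <| by
    rw [← h, neighbor_neighbor]
  have key := units_mul_eq_neg_mul_of_odd_count _ _ _ _ <|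
    A.odd_negative d e hde u _ _ _ hne (A.neighbor_ne hde u)
      (A.bicolored_adj_iff.2 (Or.inl h1)) (A.bicolored_adj_iff.2 (Or.inr h2))
      (A.bicolored_adj_iff.2 (Or.inl h3)) (A.bicolored_adj_iff.2 (Or.inr h4))
  rw [A.neighbor_comm hde, A.signedAdjMatrix_symm u (A.neighbor e u),
    A.signedAdjMatrix_symm (A.neighbor e u) (A.neighbor e (A.neighbor d u)), A.signedAdjMatrix_of_adj h1.1,
    A.signedAdjMatrix_of_adj h2.1, A.signedAdjMatrix_of_adj h3.1, A.signedAdjMatrix_of_adj h4.1]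
  exact key

/-! ### Color matrices and rank estimates -/

section Matrices

variable [Fintype V] [DecidableEq V]

/-- The part of the signed adjacency matrix supported on the edges of color `d`. -/
noncomputable def colorMatrix (A : Adinkra N V) (d : Fin N) : Matrix V V ℤ :=
  Matrix.of fun u w => if w = A.neighbor d u then A.signedAdjMatrix u w else 0

theorem colorMatrix_mul_apply (A : Adinkra N V) (d e : Fin N) (u w : V) :
    (A.colorMatrix d * A.colorMatrix e) u w = if w = A.neighbor e (A.neighbor d u) then
      A.signedAdjMatrix u (A.neighbor d u) * A.signedAdjMatrix (A.neighbor d u) w else 0 := by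
  rw [Matrix.mul_apply, Finset.sum_eq_single (A.neighbor d u)]
  · simp [colorMatrix]
  · intro j _ hj
    simp [colorMatrix, hj]
  · simp

theorem colorMatrix_mul_self (A : Adinkra N V) (d : Fin N) :
    A.colorMatrix d * A.colorMatrix d = 1 := by
  ext u w
  rw [colorMatrix_mul_apply, neighbor_neighbor, Matrix.one_apply]
  by_cases h : w = u
  · subst h
    rw [if_pos rfl, if_pos rfl, A.signedAdjMatrix_symm (A.neighbor d w),
      A.signedAdjMatrix_mul_self (A.colorAdj_neighbor d w).1]
  · rw [if_neg h, if_neg (Ne.symm h)]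

theorem colorMatrix_anticomm (A : Adinkra N V) {d e : Fin N} (hde : d ≠ e) :
    A.colorMatrix d * A.colorMatrix e = -(A.colorMatrix e * A.colorMatrix d) := by
  ext u w
  rw [Matrix.neg_apply, colorMatrix_mul_apply, colorMatrix_mul_apply, A.neighbor_comm hde]
  split_ifs with h
  · rw [h, A.signedAdjMatrix_anticomm hde, A.neighbor_comm hde]
  · simp

theorem laplacian_apply_ne (A : Adinkra N V) {u w : V} (h : u ≠ w) :
    A.laplacian u w = -A.signedAdjMatrix u w := by
  simp [laplacian, h]

/-- The weight that the deformed Laplacian for the color `c` gives to the edges of color `d`. -/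
noncomputable def weight (c d : Fin N) : ℤ[X] := if d = c then X else 1

theorem deformedLaplacian_eq (A : Adinkra N V) (c : Fin N) :
    A.deformedLaplacian c = (X + ((N : ℤ[X]) - 1)) • (1 : Matrix V V ℤ[X]) -
      ∑ d, weight c d • (A.colorMatrix d).map C := by
  ext1 u w
  simp only [deformedLaplacian, Matrix.of_apply, Matrix.sub_apply, Matrix.smul_apply,
    Matrix.sum_apply, Matrix.map_apply, Matrix.one_apply, smul_eq_mul]
  by_cases hadj : A.graph.Adj u w
  · obtain ⟨d, hd⟩ : ∃ d, A.ColorAdj d u w := ⟨_, hadj, rfl⟩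
    rw [if_neg hadj.ne, if_neg hadj.ne, Finset.sum_eq_single d]
    · have hc : (∃ h : A.graph.Adj u w, A.color ⟨s(u, w), h⟩ = c) ↔ d = c :=
        ⟨fun h => hd.color_unique h, fun h => h ▸ hd⟩
      simp only [hc, A.laplacian_apply_ne hadj.ne, weight, colorMatrix, Matrix.of_apply,
        if_pos (A.colorAdj_iff.1 hd)]
      split_ifs <;> simp [mul_comm]
    · intro e _ he
      have : ¬ w = A.neighbor e u := fun h => he ((A.colorAdj_iff.2 h).color_unique hd)
      simp [colorMatrix, this]
    · simp
  · have h0 : ∀ d, ¬ w = A.neighbor d u := fun d h => hadj (A.colorAdj_iff.2 h).1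
    have hc : ¬ ∃ h : A.graph.Adj u w, A.color ⟨s(u, w), h⟩ = c := fun h => hadj h.1
    rw [if_neg hc]
    by_cases h : u = w
    · subst h
      simp [colorMatrix, h0]
    · rw [if_neg h, if_neg h, A.laplacian_apply_ne h]
      simp [colorMatrix, h0, signedAdjMatrix, hadj]

/-- The cross terms cancel in pairs by anticommutation. Pairing (d, e) with (e, d) counts the square
twice, so 2 has to be cancelled at the end. -/
theorem sum_smul_colorMatrix_mul_self {K : Type*} [Field K] [NeZero (2 : K)] (A : Adinkra N V)
    (w : Fin N → K) :
    (∑ d, w d • (A.colorMatrix d).map (Int.castRingHom K)) *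
        (∑ d, w d • (A.colorMatrix d).map (Int.castRingHom K)) =
      (∑ d, w d * w d) • (1 : Matrix V V K) := by
  set M : Fin N → Matrix V V K := fun d => (A.colorMatrix d).map (Int.castRingHom K) with hM
  have hself : ∀ d, M d * M d = 1 := fun d => by
    simp only [hM]
    rw [← Matrix.map_mul, A.colorMatrix_mul_self]
    exact Matrix.map_one _ (map_zero _) (map_one _)
  have hanti : ∀ d e, d ≠ e → M d * M e + M e * M d = 0 := fun d e hde => by
    simp only [hM]
    rw [← Matrix.map_mul, ← Matrix.map_mul, A.colorMatrix_anticomm hde]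
    ext; simp
  have hsum : (∑ d, w d • M d) * (∑ d, w d • M d) =
      ∑ d, ∑ e, (w d * w e) • (M d * M e) := by
    simp [Finset.sum_mul_sum, smul_smul, mul_comm]
  have h2 : (2 : K) • ((∑ d, w d • M d) * (∑ d, w d • M d)) =
      (2 : K) • ((∑ d, w d * w d) • (1 : Matrix V V K)) := by
    rw [two_smul]
    nth_rewrite 2 [hsum]
    rw [Finset.sum_comm, hsum, ← Finset.sum_add_distrib, Finset.sum_smul, Finset.smul_sum]
    refine Finset.sum_congr rfl fun d _ => ?_
    rw [← Finset.sum_add_distrib, Finset.sum_eq_single d]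
    · rw [hself, two_smul]
    · intro e _ he
      rw [mul_comm (w e), ← smul_add, hanti _ _ he.symm, smul_zero]
    · simp
  exact smul_right_injective _ (NeZero.ne (2 : K)) h2

/-- No edge stays inside a class of the bipartition, so each class gives a principal submatrix equal
to an invertible scalar, and the two classes exhaust the vertices. -/
theorem card_le_two_mul_rank (A : Adinkra N V) (c : Fin N) {K : Type*} [Field K]
    (φ : ℤ[X] →+* K) (hφ : φ (X + ((N : ℤ[X]) - 1)) ≠ 0) :
    Fintype.card V ≤ 2 * ((A.deformedLaplacian c).map φ).rank := by
  obtain ⟨χ⟩ := A.bipartite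
  have hsub : ∀ i : Fin 2,
      Fintype.card {u // χ u = i} ≤ ((A.deformedLaplacian c).map φ).rank := fun i => by
    have h : ((A.deformedLaplacian c).map φ).submatrix (fun u : {u // χ u = i} => u.1)
        (fun u : {u // χ u = i} => u.1) =
        φ (X + ((N : ℤ[X]) - 1)) • (1 : Matrix {u // χ u = i} {u // χ u = i} K) := by
      ext u w
      have h0 : ∀ d, ¬ w.1 = A.neighbor d u.1 := fun d h =>
        A.two_coloring_ne χ d u.1 (by rw [← h, u.2, w.2])
      by_cases huw : u = w
      · subst huw
        simp [deformedLaplacian_eq, Matrix.sum_apply, colorMatrix, h0]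
      · simp [deformedLaplacian_eq, Matrix.sum_apply, colorMatrix, h0, Subtype.val_inj, huw]
    calc Fintype.card {u // χ u = i}
        = (φ (X + ((N : ℤ[X]) - 1)) • (1 : Matrix {u // χ u = i} {u // χ u = i} K)).rank := by
          classical
          rw [Matrix.smul_one_eq_diagonal, Matrix.rank_diagonal]
          exact Fintype.card_congr (Equiv.subtypeUnivEquiv fun _ => hφ).symm
      _ ≤ _ := by
          rw [← h]
          exact Matrix.rank_submatrix_le _ _ _
  have hcard : Fintype.card V = Fintype.card {u // χ u = 0} + Fintype.card {u // χ u = 1} := by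
    rw [Fintype.card_subtype, Fintype.card_subtype, ← Finset.card_univ]
    rw [← Finset.card_filter_add_card_filter_not (fun u => χ u = 0)]
    congr 2
    ext u
    simp
    omega
  have := hsub 0
  have := hsub 1
  omega

theorem rank_deformedLaplacian_of_root (A : Adinkra N V) (c : Fin N) {K : Type*} [Field K]
    [CharZero K] (φ : ℤ[X] →+* K) (hφ : φ (X + ((N : ℤ[X]) - 1)) = 0) :
    ((A.deformedLaplacian c).map φ).rank = Fintype.card V := by
  set B : Matrix V V K := ∑ d, φ (weight c d) • (A.colorMatrix d).map (Int.castRingHom K) with hB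
  have hL : (A.deformedLaplacian c).map φ = -B := by
    ext u w
    have hφ' : φ X + ((N : K) - 1) = 0 := by simpa using hφ
    simp [deformedLaplacian_eq, hB, Matrix.sum_apply, hφ']
  have hX : φ X = 1 - N := by
    have : φ X + ((N : K) - 1) = 0 := by simpa using hφ
    linear_combination this
  -- Color `c` contributes (1 - N)² and each of the other N - 1 colors contributes 1.
  have hw : ∑ d, φ (weight c d) * φ (weight c d) = (N : K) * (N - 1) := by
    have : ∀ d : Fin N, φ (weight c d) * φ (weight c d) =
        1 + if d = c then (1 - (N : K)) ^ 2 - 1 else 0 := fun d => by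
      unfold weight
      split_ifs
      · rw [hX]; ring
      · simp
    simp only [this, Finset.sum_add_distrib, Finset.sum_ite_eq', Finset.mem_univ, if_true]
    simp
    ring
  have hN : (N : K) * (N - 1) ≠ 0 := by
    have h2 := A.two_le
    have h1 : (N : K) ≠ 1 := by exact_mod_cast (by omega : N ≠ 1)
    have h0 : (N : K) ≠ 0 := by exact_mod_cast (by omega : N ≠ 0)
    exact mul_ne_zero h0 (sub_ne_zero.2 h1)
  have hBB : B * B = ((N : K) * (N - 1)) • (1 : Matrix V V K) := by
    rw [hB, A.sum_smul_colorMatrix_mul_self, hw]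
  have hunit : IsUnit (-B) := by
    refine IsUnit.of_mul_eq_one (-(((N : K) * (N - 1))⁻¹ • B)) ?_
    rw [neg_mul_neg, Matrix.mul_smul, hBB, smul_smul, inv_mul_cancel₀ hN, one_smul]
  rw [hL, Matrix.rank_of_isUnit _ hunit]

open scoped Classical in
theorem degree_eq (A : Adinkra N V) (u : V) : A.graph.degree u = N := by
  have h : A.graph.neighborFinset u = Finset.univ.image fun d => A.neighbor d u := by
    ext w
    simp only [SimpleGraph.mem_neighborFinset, Finset.mem_image, Finset.mem_univ, true_and]
    constructor
    · intro h
      exact ⟨_, (A.colorAdj_iff.1 ⟨h, rfl⟩).symm⟩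
    · rintro ⟨d, rfl⟩
      exact (A.colorAdj_neighbor d u).1
  rw [← SimpleGraph.card_neighborFinset_eq_degree, h, Finset.card_image_of_injective]
  · simp
  · intro d e hde
    by_contra hne
    exact A.neighbor_ne hne u hde

/-- Signs disappear modulo 2, and x = 1 turns the diagonal into N, the common degree. -/
theorem rank_deformedLaplacian_mod_two (A : Adinkra N V) (c : Fin N) :
    ((A.deformedLaplacian c).map (eval₂RingHom (Int.castRingHom (ZMod 2)) 1)).rank =
      A.twoRank := by
  classical
  unfold twoRank
  congr 1
  ext u w
  by_cases huw : u = w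
  · subst huw
    simp [deformedLaplacian, SimpleGraph.lapMatrix, SimpleGraph.degMatrix, A.degree_eq]
  · by_cases hadj : A.graph.Adj u w
    · have hs : ((A.signedAdjMatrix u w : ℤ) : ZMod 2) = 1 := by
        rw [A.signedAdjMatrix_of_adj hadj]
        rcases Int.units_eq_one_or (A.sign ⟨s(u, w), hadj⟩) with h | h <;> rw [h] <;> decide
      simp only [deformedLaplacian, Matrix.map_apply, Matrix.of_apply, if_neg huw,
        A.laplacian_apply_ne huw]
      split_ifs <;>
        simp [hs, SimpleGraph.lapMatrix, SimpleGraph.degMatrix, huw, hadj]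
    · simp [deformedLaplacian, huw, hadj, A.laplacian_apply_ne huw, signedAdjMatrix,
        SimpleGraph.lapMatrix, SimpleGraph.degMatrix]

theorem card_le_two_mul_rank_of_charZero (A : Adinkra N V) (c : Fin N) {K : Type*} [Field K]
    [CharZero K] (φ : ℤ[X] →+* K) :
    Fintype.card V ≤ 2 * ((A.deformedLaplacian c).map φ).rank := by
  by_cases h : φ (X + ((N : ℤ[X]) - 1)) = 0
  · rw [A.rank_deformedLaplacian_of_root c φ h]
    omega
  · exact A.card_le_two_mul_rank c φ h

end Matrices

end Adinkra

/-! ### Ranks read off from invariant factors -/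

section SmithNormalForm

variable {R ι : Type*} [CommRing R] [Fintype ι] [DecidableEq ι]

/-- If `M` has a Smith normal form, its rank over a field `K` can be read off from the invariant
factors: the `k`-th one vanishes in `K` exactly when the rank is at most `k`. -/
theorem HasSmithNormalForm.exists_map_eq_zero_iff {M : Matrix ι ι R}
    (hM : HasSmithNormalForm M) :
    ∃ f : Fin (Fintype.card ι) → R, ∀ {K : Type*} [Field K] (φ : R →+* K)
      (k : Fin (Fintype.card ι)), φ (f k) = 0 ↔ (M.map φ).rank ≤ k := by
  classical
  obtain ⟨P, Q, e, f, hf, h⟩ := hM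
  refine ⟨f, fun {K} _ φ k => ?_⟩
  have hrank : (M.map φ).rank = (Finset.univ.filter fun i => φ (f i) ≠ 0).card := by
    have hmap : P.1.map φ * M.map φ * Q.1.map φ = Matrix.diagonal fun i => φ (f (e i)) := by
      rw [← Matrix.map_mul, ← Matrix.map_mul, h, Matrix.diagonal_map (map_zero φ)]
    have hdet : ∀ U : Matrix.GeneralLinearGroup ι R, IsUnit (U.1.map φ).det := fun U => by
      rw [← RingHom.mapMatrix_apply, ← RingHom.map_det]
      exact ((Matrix.isUnit_iff_isUnit_det _).1 U.isUnit).map φ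
    rw [← Matrix.rank_mul_eq_right_of_isUnit_det _ (M.map φ) (hdet P),
      ← Matrix.rank_mul_eq_left_of_isUnit_det _ (P.1.map φ * M.map φ) (hdet Q), hmap,
      Matrix.rank_diagonal, ← Fintype.card_subtype]
    exact Fintype.card_congr (e.subtypeEquiv fun i => Iff.rfl)
  -- Divisibility makes the surviving indices an initial segment, so their number decides whether
  -- `k` is among them.
  have hmono : ∀ i j, i ≤ j → φ (f i) = 0 → φ (f j) = 0 := fun i j hij hi =>
    zero_dvd_iff.1 (hi ▸ map_dvd φ (hf i j hij))
  rw [hrank]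
  constructor
  · intro hk
    rw [← Fin.card_Iio]
    refine Finset.card_le_card fun i hi => ?_
    rw [Finset.mem_Iio]
    by_contra! hki
    exact (Finset.mem_filter.1 hi).2 (hmono k i hki hk)
  · intro hk
    by_contra hne
    have : (Finset.Iic k).card ≤ (Finset.univ.filter fun i => φ (f i) ≠ 0).card :=
      Finset.card_le_card fun i hi =>
        Finset.mem_filter.2 ⟨Finset.mem_univ _, fun h0 => hne (hmono i k (Finset.mem_Iic.1 hi) h0)⟩
    rw [Fin.card_Iic] at this
    omega

end SmithNormalForm

theorem proposition4p1 {N : ℕ} {V : Type*} [Fintype V] [DecidableEq V]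
    (A : Adinkra N V) (hA : A.IsNonGeneric) (c : Fin N) :
    ¬ HasSmithNormalForm (A.deformedLaplacian c) := by
  intro hS
  obtain ⟨f, hf⟩ := hS.exists_map_eq_zero_iff
  have hlt : 2 * A.twoRank < Fintype.card V := by
    have h : (0 : ℚ) < (Fintype.card V : ℚ) / 2 - A.twoRank := hA
    have h' : (2 * A.twoRank : ℚ) < Fintype.card V := by linarith
    exact_mod_cast h'
  -- Counting starts at 0, so this is the first invariant factor to vanish at x = 1 over 𝔽₂.
  let k : Fin (Fintype.card V) := ⟨A.twoRank, by omega⟩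
  have hone : (f k).eval₂ (Int.castRingHom (ZMod 2)) 1 = 0 :=
    (hf (eval₂RingHom (Int.castRingHom (ZMod 2)) 1) k).2 (A.rank_deformedLaplacian_mod_two c).le
  -- Over 𝔽₂(x) the element x + N - 1 is nonzero, so the rank there is at least v/2 > k.
  have hmod : (f k).map (Int.castRingHom (ZMod 2)) ≠ 0 := by
    intro h0
    let φ : ℤ[X] →+* FractionRing (ZMod 2)[X] :=
      (algebraMap (ZMod 2)[X] _).comp (mapRingHom (Int.castRingHom (ZMod 2)))
    have hy : φ (X + ((N : ℤ[X]) - 1)) ≠ 0 := by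
      have : mapRingHom (Int.castRingHom (ZMod 2)) (X + ((N : ℤ[X]) - 1)) =
          X + C ((N : ZMod 2) - 1) := by simp
      rw [RingHom.comp_apply, this]
      exact (map_ne_zero_iff _ (IsFractionRing.injective _ _)).2 (X_add_C_ne_zero _)
    have hk := (hf φ k).1 (by simp [φ, h0])
    have := A.card_le_two_mul_rank c φ hy
    have : k.1 = A.twoRank := rfl
    omega
  -- A constant that vanishes at x = 1 modulo 2 would be zero modulo 2.
  have hdeg : (f k).degree ≠ 0 := by
    intro h0
    rw [eq_C_of_degree_eq_zero h0] at hone hmod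
    rw [eval₂_C] at hone
    exact hmod (by rw [map_C, hone, C_0])
  have hdeg' : ((f k).map (Int.castRingHom ℂ)).degree ≠ 0 := by
    rwa [degree_map_eq_of_injective (RingHom.injective_int _)]
  obtain ⟨r, hr⟩ := IsAlgClosed.exists_root _ hdeg'
  rw [IsRoot.def, eval_map] at hr
  have hk := (hf (eval₂RingHom (Int.castRingHom ℂ) r) k).1 hr
  have := A.card_le_two_mul_rank_of_charZero c (eval₂RingHom (Int.castRingHom ℂ) r)
  have : k.1 = A.twoRank := rfl
  omega
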